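/- The Urysohn space $\mathbb{U}$ is the complete separable metric space, unique up to isometry, with the one-point extension property: for every finite $A\subseteq\mathbb{U}$ and every $f:A\to\mathbb{R}$ with $|f(a)-f(b)|\le d(a,b)\le f(a)+f(b)$ for all $a,b\in A$, there is $x\in\mathbb{U}$ with $d(x,a)=f(a)$ for all $a\in A$. A $1$-Lipschitz retraction of a metric space $X$ onto $G\subseteq X$ is a $1$-Lipschitz map $r:X\to G$ with $r(x)=x$ for all $x\in G$. **Theorem.** The Urysohn space $\mathbb{U}$ exists, and there are a proper subset $F_{\mathbb{U}}\subsetneq\mathbb{U}$, isometric to $\mathbb{U}$, and a $1$-Lipschitz retraction $R$ of $\mathbb{U}$ onto $F_{\mathbb{U}}$ such that: 1. (universality) for every Polish metric space $X$ (that is, complete and separable) and every $1$-Lipschitz retraction $r$ of $X$ onto a subset $G\subseteq X$ there is an isometric embedding $\iota:X\to\mathbb{U}$ such that $R(\iota(x))=\iota(r(x))$ and $\operatorname{dist}(\iota(x),F_{\mathbb{U}})=\operatorname{dist}(x,G)$ for all $x\in X$; 2. (ultrahomogeneity) whenever $A,B\subseteq\mathbb{U}$ are finite sets with $R(A)\subseteq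 A$ and $R(B)\subseteq B$, and $e:A\to B$ is a surjective isometry such that $R(e(a))=e(R(a))$ and $\operatorname{dist}(e(a),F_{\mathbb{U}})=\operatorname{dist}(a,F_{\mathbb{U}})$ for all $a\in A$, there is a surjective isometry $\Phi:\mathbb{U}\to\mathbb{U}$ with $\Phi\circ R=R\circ\Phi$ and $\Phi(a)=e(a)$ for all $a\in A$. -/

import Mathlib

open Set Metric TopologicalSpace

universe u v

/-- `U` is (an isometric copy of) the Urysohn space: it is complete, separable, and every abstract
one-point metric extension of a finite subset `A` of `U`, given by the distances `f a` of the new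
point to the points `a ∈ A`, is realized by a point of `U`.  (For `A = ∅` this says that `U` is
nonempty.) -/
structure IsUrysohnSpace (U : Type u) [MetricSpace U] : Prop where
  complete : CompleteSpace U
  separable : SeparableSpace U
  one_point_extension : ∀ (A : Set U) (f : U → ℝ), A.Finite →
    (∀ a ∈ A, ∀ b ∈ A, |f a - f b| ≤ dist a b ∧ dist a b ≤ f a + f b) →
    ∃ x : U, ∀ a ∈ A, dist x a = f a

/-- `r` is a `1`-Lipschitz retraction of `X` onto its subset `G`. -/
structure IsLipschitzRetraction {X : Type u} [MetricSpace X] (r : X → X) (G : Set X) : Prop where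
  lipschitz : LipschitzWith 1 r
  mem : ∀ x, r x ∈ G
  fixed : ∀ x ∈ G, r x = x

/-- Universality of a retraction `R : U → F`: every Polish metric space with a `1`-Lipschitz
retraction embeds isometrically into `U` so that the embedding commutes with the retractions and
preserves the distance to the retract. -/
def IsUniversalRetraction {U : Type u} [MetricSpace U] (R : U → U) (F : Set U) : Prop :=
  ∀ (X : Type v) [MetricSpace X] [CompleteSpace X] [SeparableSpace X] (r : X → X) (G : Set X),
    IsLipschitzRetraction r G →
    ∃ i : X → U, Isometry i ∧ (∀ x, R (i x) = i (r x)) ∧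
      ∀ x, infDist (i x) F = infDist x G

/-- Ultrahomogeneity of a retraction `R : U → F`: every isomorphism `e : A → B` between finite
substructures (finite subsets closed under `R`) extends to an automorphism of `(U, R)`.
Here an isomorphism is an isometry that commutes with `R` and preserves the distance to `F`.  (An
isometry of `U` onto itself that commutes with `R` preserves the distance to `F = R(U)`.) -/
def IsUltrahomogeneousRetraction {U : Type u} [MetricSpace U] (R : U → U) (F : Set U) : Prop :=
  ∀ (A B : Set U) (hA : MapsTo R A A) (_ : MapsTo R B B), A.Finite → B.Finite →
    ∀ e : A ≃ᵢ B,
      (∀ a : A, R (e a : U) = e ⟨R a, hA a.2⟩) →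
      (∀ a : A, infDist (e a : U) F = infDist (a : U) F) →
      ∃ Φ : U ≃ᵢ U, (∀ x, R (Φ x) = Φ (R x)) ∧ ∀ a : A, Φ a = e a

/-! The pair `(U, R)` is a Fraïssé limit in the metric sense. The distance to the retract is an
infimum over infinitely many points, so it is replaced by an abstract height `p`. The height is
1-Lipschitz, vanishes on the range of `r`, and satisfies `d x (r x) ≤ 2 * p x`. With this,
everything needed about a new point `x` and its image is carried by a type: two distance functions,
their mutual distance `D`, and the height `q`. The axioms of a type are exactly what lets the pair
be adjoined (`IsRetractStructure.extension`).

A countable structure is built by adjoining pairs that approximate every type on finite sets, and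
then completed. In the completion types are realized exactly on finite sets. An approximate
realization can be corrected by moving it about as far as its error (`exists_refinement`), so
repeated correction gives a Cauchy sequence whose limit realizes the type. Types prescribed on a
finite family closed under `r` extend to the whole space by the largest 1-Lipschitz extension,
`minExt`.

The rest follows from exact realization. A fixed point at distance `P x` from `x` is realized, so
the abstract height is the true distance to the fixed-point set. Types with `D = q = 0` show that
the fixed-point set is Urysohn, and an arbitrary one-point metric extension can be completed to a
type, so the whole space is Urysohn too. The forth argument gives universality, and back-and-forth
gives ultrahomogeneity and the uniqueness of the Urysohn space. Uniqueness transports the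
construction to any given `U`. -/

/-! ### Structures, types and generators -/

/-- A pseudometric `d` with an idempotent `1`-Lipschitz map `r` and a `1`-Lipschitz function `p`
that has the formal properties of the distance to the range of `r`. -/
structure IsRetractStructure {X : Type*} (d : X → X → ℝ) (r : X → X) (p : X → ℝ) : Prop where
  self : ∀ x, d x x = 0
  symm : ∀ x y, d x y = d y x
  tri : ∀ x y z, d x z ≤ d x y + d y z
  lip : ∀ x y, d (r x) (r y) ≤ d x y
  idem : ∀ x, r (r x) = r x
  height_lip : ∀ x y, p x ≤ p y + d x y
  height_map : ∀ x, p (r x) = 0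
  dist_map_le : ∀ x, d x (r x) ≤ 2 * p x

/-- `(f, g, D, q)` describes a new point `x` and its image `r x`: their distances to the old points
are given by `f` and `g`, their mutual distance is `D`, and the height of `x` is `q`. -/
structure IsRetractType {X : Type*} (d : X → X → ℝ) (r : X → X) (p : X → ℝ)
    (f g : X → ℝ) (D q : ℝ) : Prop where
  f_lip : ∀ x y, f x ≤ f y + d x y
  f_tri : ∀ x y, d x y ≤ f x + f y
  g_lip : ∀ x y, g x ≤ g y + d x y
  g_tri : ∀ x y, d x y ≤ g x + g y
  g_map_le_f : ∀ x, g (r x) ≤ f x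
  g_map_le_g : ∀ x, g (r x) ≤ g x
  height_le : ∀ x, q ≤ p x + f x
  le_height : ∀ x, p x ≤ q + f x
  le_g : ∀ x, p x ≤ g x
  f_le : ∀ x, f x ≤ g x + D
  g_le : ∀ x, g x ≤ f x + D
  le_add : ∀ x, D ≤ f x + g x
  q_le : q ≤ D
  le_q : D ≤ 2 * q

/-- Bounds `u`, `v` for the distances of a new point and of its image to a family `z` of old points
that is closed under `r`; they generate a type. -/
structure IsGenerator {X ι : Type*} (d : X → X → ℝ) (p : X → ℝ) (r : X → X)
    (z : ι → X) (ρ : ι → ι) (u v : ι → ℝ) (D q : ℝ) : Prop where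
  map : ∀ i, z (ρ i) = r (z i)
  u_tri : ∀ i j, d (z i) (z j) ≤ u i + u j
  v_tri : ∀ i j, d (z i) (z j) ≤ v i + v j
  v_map_le_u : ∀ i, v (ρ i) ≤ u i
  v_map_le_v : ∀ i, v (ρ i) ≤ v i
  height_le : ∀ i, q ≤ p (z i) + u i
  le_height : ∀ i, p (z i) ≤ q + u i
  le_v : ∀ i, p (z i) ≤ v i
  u_le : ∀ i, u i ≤ v i + D
  v_le : ∀ i, v i ≤ u i + D
  le_add : ∀ i j, D ≤ u i + v j + d (z i) (z j)
  q_le : q ≤ D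
  le_q : D ≤ 2 * q

namespace IsRetractStructure

variable {X Y : Type*} {d : X → X → ℝ} {r : X → X} {p : X → ℝ}

theorem nonneg (h : IsRetractStructure d r p) (x y : X) : 0 ≤ d x y := by
  have := h.tri x y x
  rw [h.self, h.symm y x] at this
  linarith

theorem height_nonneg (h : IsRetractStructure d r p) (x : X) : 0 ≤ p x := by
  linarith [h.nonneg x (r x), h.dist_map_le x]

theorem height_le_dist_map (h : IsRetractStructure d r p) (x y : X) : p x ≤ d x (r y) := by
  linarith [h.height_lip x (r y), h.height_map y]

/-- A structure pulls back along an equivariant map. -/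
theorem comap (h : IsRetractStructure d r p) (φ : Y → X) (s : Y → Y)
    (hφ : ∀ y, φ (s y) = r (φ y)) (hs : ∀ y, s (s y) = s y) :
    IsRetractStructure (fun x y => d (φ x) (φ y)) s (fun y => p (φ y)) where
  self _ := h.self _
  symm _ _ := h.symm _ _
  tri _ _ _ := h.tri _ _ _
  lip _ _ := by simpa only [hφ] using h.lip _ _
  idem := hs
  height_lip _ _ := h.height_lip _ _
  height_map _ := by simpa only [hφ] using h.height_map _
  dist_map_le _ := by simpa only [hφ] using h.dist_map_le _

/-- A type pulls back along an equivariant map. -/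
theorem _root_.IsRetractType.comap {f g : X → ℝ} {D q : ℝ} (h : IsRetractType d r p f g D q)
    (φ : Y → X) (s : Y → Y) (hφ : ∀ y, φ (s y) = r (φ y)) :
    IsRetractType (fun x y => d (φ x) (φ y)) s (fun y => p (φ y)) (fun y => f (φ y))
      (fun y => g (φ y)) D q where
  f_lip _ _ := h.f_lip _ _
  f_tri _ _ := h.f_tri _ _
  g_lip _ _ := h.g_lip _ _
  g_tri _ _ := h.g_tri _ _
  g_map_le_f _ := by simpa only [hφ] using h.g_map_le_f _
  g_map_le_g _ := by simpa only [hφ] using h.g_map_le_g _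
  height_le _ := h.height_le _
  le_height _ := h.le_height _
  le_g _ := h.le_g _
  f_le _ := h.f_le _
  g_le _ := h.g_le _
  le_add _ := h.le_add _
  q_le := h.q_le
  le_q := h.le_q

end IsRetractStructure

/-! ### Adjoining a point and its image -/

section Extension

variable {X : Type*}

/-- The distance on `X` with two points `inr true`, `inr false` added. -/
def extDist (d : X → X → ℝ) (f g : X → ℝ) (D : ℝ) : X ⊕ Bool → X ⊕ Bool → ℝ
  | .inl x, .inl y => d x y
  | .inl x, .inr true => f x
  | .inl x, .inr false => g x
  | .inr true, .inl y => f y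
  | .inr false, .inl y => g y
  | .inr true, .inr true => 0
  | .inr false, .inr false => 0
  | .inr true, .inr false => D
  | .inr false, .inr true => D

/-- The retraction on the extension, mapping `inr true` to `inr false`. -/
def extMap (r : X → X) : X ⊕ Bool → X ⊕ Bool
  | .inl x => .inl (r x)
  | .inr _ => .inr false

/-- The height function on the extension. -/
def extHeight (p : X → ℝ) (q : ℝ) : X ⊕ Bool → ℝ
  | .inl x => p x
  | .inr true => q
  | .inr false => 0

variable {d : X → X → ℝ} {r : X → X} {p : X → ℝ} {f g : X → ℝ} {D q : ℝ}

theorem IsRetractType.f_nonneg (h : IsRetractStructure d r p) (t : IsRetractType d r p f g D q)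
    (x : X) : 0 ≤ f x := by
  linarith [t.f_tri x x, h.self x]

theorem IsRetractType.g_nonneg (h : IsRetractStructure d r p) (t : IsRetractType d r p f g D q)
    (x : X) : 0 ≤ g x := by
  linarith [t.g_tri x x, h.self x]

/-- The fields of a type are the structure axioms for those tuples that involve a new point, so the
proof is a check by cases on old and new points. -/
theorem IsRetractStructure.extension (h : IsRetractStructure d r p)
    (t : IsRetractType d r p f g D q) :
    IsRetractStructure (extDist d f g D) (extMap r) (extHeight p q) where
  self := by rintro (x | _ | _) <;> simp [extDist, h.self]
  symm := by rintro (x | _ | _) (y | _ | _) <;> simp [extDist, h.symm]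
  tri := by
    have := t.q_le
    have := t.le_q
    rintro (x | _ | _) (y | _ | _) (z | _ | _) <;> simp only [extDist]
    all_goals first
      | linarith
      | exact h.tri _ _ _
      | linarith [t.f_lip x y, t.f_lip y x, t.g_lip x y, t.g_lip y x, h.symm x y]
      | linarith [t.f_lip z y, t.g_lip z y, h.symm z y]
      | linarith [t.f_tri x z, t.g_tri x z]
      | linarith [t.f_le x, t.g_le x, t.le_add x]
      | linarith [t.f_le z, t.g_le z, t.le_add z]
      | linarith [t.f_le y, t.g_le y, t.le_add y, t.f_nonneg h y, t.g_nonneg h y]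
  lip := by
    have := t.q_le
    have := t.le_q
    rintro (x | _ | _) (y | _ | _) <;> simp only [extDist, extMap]
    all_goals first
      | linarith
      | exact h.lip _ _
      | exact t.g_map_le_f _
      | exact t.g_map_le_g _
  idem := by rintro (x | _ | _) <;> simp [extMap, h.idem]
  height_lip := by
    have := t.q_le
    have := t.le_q
    rintro (x | _ | _) (y | _ | _) <;> simp only [extDist, extHeight]
    all_goals first
      | linarith
      | exact h.height_lip _ _
      | exact t.height_le _
      | exact t.le_height _
      | linarith [t.le_g x]
      | linarith [h.height_nonneg y, t.g_nonneg h y]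
  height_map := by rintro (x | _ | _) <;> simp [extMap, extHeight, h.height_map]
  dist_map_le := by
    rintro (x | _ | _) <;> simp [extMap, extHeight, extDist, h.dist_map_le, t.le_q]

end Extension

/-! ### Types generated by finite data -/

section MinExt

variable {X ι : Type*} [Finite ι] {d : X → X → ℝ} {r : X → X} {p : X → ℝ}

/-- The largest function with values at most `u i` at `z i` that is `1`-Lipschitz. -/
noncomputable def minExt (d : X → X → ℝ) (z : ι → X) (u : ι → ℝ) (x : X) : ℝ :=
  ⨅ i, (u i + d (z i) x)

theorem minExt_le (d : X → X → ℝ) (z : ι → X) (u : ι → ℝ) (x : X) (i : ι) :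
    minExt d z u x ≤ u i + d (z i) x :=
  ciInf_le (Set.finite_range _).bddBelow i

theorem exists_minExt_eq [Nonempty ι] (d : X → X → ℝ) (z : ι → X) (u : ι → ℝ) (x : X) :
    ∃ i, minExt d z u x = u i + d (z i) x := by
  obtain ⟨i, hi⟩ := exists_eq_ciInf_of_finite (f := fun i => u i + d (z i) x)
  exact ⟨i, hi.symm⟩

theorem minExt_apply [Nonempty ι] (h : IsRetractStructure d r p) (z : ι → X) (u : ι → ℝ) (i : ι)
    (hi : ∀ j, u i ≤ u j + d (z j) (z i)) : minExt d z u (z i) = u i := by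
  apply le_antisymm
  · simpa [h.self] using minExt_le d z u (z i) i
  · obtain ⟨j, hj⟩ := exists_minExt_eq d z u (z i)
    exact hj ▸ hi j

variable {z : ι → X} {ρ : ι → ι} {u v : ι → ℝ} {D q : ℝ}

/-- Since the family is finite, each infimum is attained at some index. Every axiom then reduces to
the generator inequality at the attaining indices and the triangle inequality. The bounds for the
point and for its image may be attained at different indices, which is why `le_add` in a generator
involves two. -/
theorem IsGenerator.isRetractType [Nonempty ι] (h : IsRetractStructure d r p)
    (t : IsGenerator d p r z ρ u v D q) :
    IsRetractType d r p (minExt d z u) (minExt d z v) D q where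
  f_lip x y := by
    obtain ⟨i, hi⟩ := exists_minExt_eq d z u y
    linarith [minExt_le d z u x i, h.tri (z i) y x, h.symm x y]
  g_lip x y := by
    obtain ⟨i, hi⟩ := exists_minExt_eq d z v y
    linarith [minExt_le d z v x i, h.tri (z i) y x, h.symm x y]
  f_tri x y := by
    obtain ⟨i, hi⟩ := exists_minExt_eq d z u x
    obtain ⟨j, hj⟩ := exists_minExt_eq d z u y
    linarith [t.u_tri i j, h.tri x (z i) y, h.tri (z i) (z j) y, h.symm x (z i)]
  g_tri x y := by
    obtain ⟨i, hi⟩ := exists_minExt_eq d z v x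
    obtain ⟨j, hj⟩ := exists_minExt_eq d z v y
    linarith [t.v_tri i j, h.tri x (z i) y, h.tri (z i) (z j) y, h.symm x (z i)]
  g_map_le_f x := by
    obtain ⟨i, hi⟩ := exists_minExt_eq d z u x
    have := minExt_le d z v (r x) (ρ i)
    rw [t.map] at this
    linarith [t.v_map_le_u i, h.lip (z i) x]
  g_map_le_g x := by
    obtain ⟨i, hi⟩ := exists_minExt_eq d z v x
    have := minExt_le d z v (r x) (ρ i)
    rw [t.map] at this
    linarith [t.v_map_le_v i, h.lip (z i) x]
  height_le x := by
    obtain ⟨i, hi⟩ := exists_minExt_eq d z u x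
    linarith [t.height_le i, h.height_lip (z i) x]
  le_height x := by
    obtain ⟨i, hi⟩ := exists_minExt_eq d z u x
    linarith [t.le_height i, h.height_lip x (z i), h.symm x (z i)]
  le_g x := by
    obtain ⟨i, hi⟩ := exists_minExt_eq d z v x
    linarith [t.le_v i, h.height_lip x (z i), h.symm x (z i)]
  f_le x := by
    obtain ⟨i, hi⟩ := exists_minExt_eq d z v x
    linarith [t.u_le i, minExt_le d z u x i]
  g_le x := by
    obtain ⟨i, hi⟩ := exists_minExt_eq d z u x
    linarith [t.v_le i, minExt_le d z v x i]
  le_add x := by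
    obtain ⟨i, hi⟩ := exists_minExt_eq d z u x
    obtain ⟨j, hj⟩ := exists_minExt_eq d z v x
    linarith [t.le_add i j, h.tri (z i) x (z j), h.symm x (z j)]
  q_le := t.q_le
  le_q := t.le_q

/-- If a point `x` approximates a type on a finite family closed under `r`, then the restriction of
the type to the family extends to a type of points near `x`. -/
theorem IsRetractType.exists_refinement [Nonempty ι] (h : IsRetractStructure d r p) {f g : X → ℝ}
    (t : IsRetractType d r p f g D q) (hz : ∀ i, z (ρ i) = r (z i)) (x : X) {s : ℝ}
    (hf : ∀ i, |d x (z i) - f (z i)| ≤ s) (hg : ∀ i, |d (r x) (z i) - g (z i)| ≤ s)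
    (hD : |d x (r x) - D| ≤ s) (hq : |p x - q| ≤ s) :
    ∃ f' g' : X → ℝ, IsRetractType d r p f' g' D q ∧ (∀ i, f' (z i) = f (z i)) ∧
      (∀ i, g' (z i) = g (z i)) ∧ f' x ≤ s := by
  simp only [abs_le] at hf hg hD hq
  have hs : 0 ≤ s := by linarith [hq.1, hq.2]
  have hqD := t.q_le
  have hDq := t.le_q
  have hpx := h.height_nonneg x
  -- The family is enlarged by `x` (`true`) and `r x` (`false`). The bounds allow the new point to
  -- lie within `s` of `x` and its image within `s` of `r x`; the two crossed distances are then at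
  -- most `s + D`.
  let z' : ι ⊕ Bool → X := Sum.elim z (fun b => if b then x else r x)
  let u : ι ⊕ Bool → ℝ := Sum.elim (fun i => f (z i)) (fun b => if b then s else s + D)
  let v : ι ⊕ Bool → ℝ := Sum.elim (fun i => g (z i)) (fun b => if b then s + D else s)
  have key : IsGenerator d p r z' (Sum.elim (fun i => .inl (ρ i)) (fun _ => .inr false)) u v D q :=
    { map := by rintro (i | _ | _) <;> simp [z', hz, h.idem]
      u_tri := by
        rintro (i | _ | _) (j | _ | _) <;> simp only [z', u, Sum.elim_inl, Sum.elim_inr, if_true,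
          Bool.false_eq_true, if_false, h.self]
        any_goals linarith
        · exact t.f_tri _ _
        · linarith [hg i, h.symm (r x) (z i), t.g_le (z i)]
        · linarith [hf i, h.symm x (z i)]
        · linarith [hg j, t.g_le (z j)]
        · linarith [h.symm x (r x)]
        · linarith [hf j]
      v_tri := by
        rintro (i | _ | _) (j | _ | _) <;> simp only [z', v, Sum.elim_inl, Sum.elim_inr, if_true,
          Bool.false_eq_true, if_false, h.self]
        any_goals linarith
        · exact t.g_tri _ _
        · linarith [hg i, h.symm (r x) (z i)]
        · linarith [hf i, h.symm x (z i), t.f_le (z i)]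
        · linarith [hg j]
        · linarith [h.symm x (r x)]
        · linarith [hf j, t.f_le (z j)]
      v_map_le_u := by
        rintro (i | _ | _) <;> simp only [u, v, Sum.elim_inl, Sum.elim_inr, if_true,
          Bool.false_eq_true, if_false, hz]
        any_goals linarith
        exact t.g_map_le_f _
      v_map_le_v := by
        rintro (i | _ | _) <;> simp only [v, Sum.elim_inl, Sum.elim_inr, if_true,
          Bool.false_eq_true, if_false, hz]
        any_goals linarith
        exact t.g_map_le_g _
      height_le := by
        rintro (i | _ | _) <;> simp only [z', u, Sum.elim_inl, Sum.elim_inr, if_true,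
          Bool.false_eq_true, if_false, h.height_map]
        any_goals linarith
        exact t.height_le _
      le_height := by
        rintro (i | _ | _) <;> simp only [z', u, Sum.elim_inl, Sum.elim_inr, if_true,
          Bool.false_eq_true, if_false, h.height_map]
        any_goals linarith
        exact t.le_height _
      le_v := by
        rintro (i | _ | _) <;> simp only [z', v, Sum.elim_inl, Sum.elim_inr, if_true,
          Bool.false_eq_true, if_false, h.height_map]
        any_goals linarith
        exact t.le_g _
      u_le := by
        rintro (i | _ | _) <;> simp only [u, v, Sum.elim_inl, Sum.elim_inr, if_true,
          Bool.false_eq_true, if_false]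
        any_goals linarith
        exact t.f_le _
      v_le := by
        rintro (i | _ | _) <;> simp only [u, v, Sum.elim_inl, Sum.elim_inr, if_true,
          Bool.false_eq_true, if_false]
        any_goals linarith
        exact t.g_le _
      le_add := by
        rintro (i | _ | _) (j | _ | _) <;> simp only [z', u, v, Sum.elim_inl, Sum.elim_inr,
          if_true, Bool.false_eq_true, if_false, h.self]
        any_goals linarith
        · linarith [t.le_add (z i), t.g_lip (z i) (z j)]
        · linarith [t.le_add (z i), hg i, h.symm (r x) (z i)]
        · linarith [t.f_nonneg h (z i), h.nonneg (z i) x]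
        · linarith [t.g_nonneg h (z j), h.nonneg (r x) (z j)]
        · linarith [h.nonneg (r x) x]
        · linarith [t.le_add (z j), hf j]
      q_le := hqD
      le_q := hDq }
  refine ⟨_, _, key.isRetractType h, fun i => ?_, fun i => ?_, ?_⟩
  · refine minExt_apply h z' u (.inl i) ?_
    rintro (j | _ | _) <;> simp only [z', u, Sum.elim_inl, Sum.elim_inr,
          if_true, Bool.false_eq_true, if_false]
    · linarith [t.f_lip (z i) (z j), h.symm (z i) (z j)]
    · linarith [hg i, t.f_le (z i)]
    · linarith [hf i]
  · refine minExt_apply h z' v (.inl i) ?_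
    rintro (j | _ | _) <;> simp only [z', v, Sum.elim_inl, Sum.elim_inr,
          if_true, Bool.false_eq_true, if_false]
    · linarith [t.g_lip (z i) (z j), h.symm (z i) (z j)]
    · linarith [hg i]
    · linarith [hf i, t.g_le (z i)]
  · simpa [z', u, h.self] using minExt_le d z' u x (.inr true)

end MinExt

/-! ### A countable structure approximating all types -/

section Countable

/-- The retraction of `ℕ × Bool` onto `ℕ × {false}`. -/
def baseMap (x : ℕ × Bool) : ℕ × Bool := (x.1, false)

/-- `f, g, D, q` is a type over the points of `ℕ × Bool` with first component less than `n`. -/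
def IsPartialType (n : ℕ) (d : ℕ × Bool → ℕ × Bool → ℝ) (p f g : ℕ × Bool → ℝ) (D q : ℝ) : Prop :=
  IsRetractType (fun x y : {x : ℕ × Bool // x.1 < n} => d x y) (fun x => ⟨baseMap x, x.2⟩)
    (fun x => p x) (fun x => f x) (fun x => g x) D q

/-- The data of `f, g, D, q` differ from the target `t` by less than `ε` at the points with first
component less than `k`. -/
def IsNear (k : ℕ) (ε : ℝ) (t : ((ℕ × Bool → ℝ) × (ℕ × Bool → ℝ)) × (ℝ × ℝ))
    (f g : ℕ × Bool → ℝ) (D q : ℝ) : Prop :=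
  (∀ x : ℕ × Bool, x.1 < k → |f x - t.1.1 x| < ε ∧ |g x - t.1.2 x| < ε) ∧
    |D - t.2.1| < ε ∧ |q - t.2.2| < ε

/-- The structure on the points of index `< n` extends so that the pair with index `n` is near the
target, if some type is. -/
theorem exists_structure_step {d : ℕ × Bool → ℕ × Bool → ℝ} {p : ℕ × Bool → ℝ}
    (h : IsRetractStructure d baseMap p) (t : ((ℕ × Bool → ℝ) × (ℕ × Bool → ℝ)) × (ℝ × ℝ)) (ε : ℝ)
    {k n : ℕ} (hk : k ≤ n) :
    ∃ d' p', IsRetractStructure d' baseMap p' ∧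
      (∀ x y : ℕ × Bool, x.1 < n → y.1 < n → d' x y = d x y) ∧
      (∀ x : ℕ × Bool, x.1 < n → p' x = p x) ∧
      ((∃ f g D q, IsPartialType n d p f g D q ∧ IsNear k ε t f g D q) →
        IsNear k ε t (d' (n, true)) (d' (n, false)) (d' (n, true) (n, false)) (p' (n, true))) := by
  by_cases H : ∃ f g D q, IsPartialType n d p f g D q ∧ IsNear k ε t f g D q
  · obtain ⟨f, g, D, q, ht, hn⟩ := H
    have h₁ := ((h.comap (Subtype.val : {x : ℕ × Bool // x.1 < n} → ℕ × Bool)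
      (fun x => ⟨baseMap x, x.2⟩) (fun _ => rfl) (fun _ => rfl)).extension ht)
    -- All pairs of index at least `n` are collapsed onto the new pair. This is harmless, because a
    -- pseudometric suffices and only indices up to `n` are kept by the next step.
    let φ : ℕ × Bool → {x : ℕ × Bool // x.1 < n} ⊕ Bool :=
      fun x => if hx : x.1 < n then .inl ⟨x, hx⟩ else .inr x.2
    have hφ : ∀ x (hx : x.1 < n), φ x = .inl ⟨x, hx⟩ := fun x hx => by simp [φ, hx]
    have hφn : ∀ b, φ (n, b) = .inr b := fun b => by simp [φ]
    refine ⟨_, _, h₁.comap φ baseMap ?_ (fun _ => rfl), ?_, ?_, fun _ => ⟨?_, ?_, ?_⟩⟩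
    · intro x
      by_cases hx : x.1 < n
      · rw [hφ x hx, hφ (baseMap x) hx]; rfl
      · simp [φ, baseMap, hx, extMap]
    · intro x y hx hy
      simp only [hφ x hx, hφ y hy, extDist]
    · intro x hx
      simp only [hφ x hx, extHeight]
    · intro x hx
      simpa only [hφ x (hx.trans_le hk), hφn, extDist] using hn.1 x hx
    · simpa only [hφn, extDist] using hn.2.1
    · simpa only [hφn, extHeight] using hn.2.2
  · exact ⟨d, p, h, fun _ _ _ _ => rfl, fun _ _ => rfl, fun H' => (H H').elim⟩

/-- A sequence of structures in which every type over the first pairs is eventually approximated. -/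
theorem exists_structure_sequence (t : ℕ → ((ℕ × Bool → ℝ) × (ℕ × Bool → ℝ)) × (ℝ × ℝ))
    (k : ℕ → ℕ) (ε : ℕ → ℝ) (hk : ∀ n, k n ≤ n) :
    ∃ (d : ℕ → ℕ × Bool → ℕ × Bool → ℝ) (p : ℕ → ℕ × Bool → ℝ),
      (∀ n, IsRetractStructure (d n) baseMap (p n)) ∧
      (∀ n, ∀ x y : ℕ × Bool, x.1 < n → y.1 < n → d (n + 1) x y = d n x y) ∧
      (∀ n, ∀ x : ℕ × Bool, x.1 < n → p (n + 1) x = p n x) ∧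
      ∀ n, (∃ f g D q, IsPartialType n (d n) (p n) f g D q ∧ IsNear (k n) (ε n) (t n) f g D q) →
        IsNear (k n) (ε n) (t n) (d (n + 1) (n, true)) (d (n + 1) (n, false))
          (d (n + 1) (n, true) (n, false)) (p (n + 1) (n, true)) := by
  let S := {s : (ℕ × Bool → ℕ × Bool → ℝ) × (ℕ × Bool → ℝ) // IsRetractStructure s.1 baseMap s.2}
  have step : ∀ (n : ℕ) (s : S), ∃ s' : S,
      (∀ x y : ℕ × Bool, x.1 < n → y.1 < n → s'.1.1 x y = s.1.1 x y) ∧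
      (∀ x : ℕ × Bool, x.1 < n → s'.1.2 x = s.1.2 x) ∧
      ((∃ f g D q, IsPartialType n s.1.1 s.1.2 f g D q ∧ IsNear (k n) (ε n) (t n) f g D q) →
        IsNear (k n) (ε n) (t n) (s'.1.1 (n, true)) (s'.1.1 (n, false))
          (s'.1.1 (n, true) (n, false)) (s'.1.2 (n, true))) := by
    intro n s
    obtain ⟨d', p', h, h'⟩ := exists_structure_step s.2 (t n) (ε n) (hk n)
    exact ⟨⟨(d', p'), h⟩, h'⟩
  choose next hnext using step
  have h₀ : IsRetractStructure (fun _ _ : ℕ × Bool => (0 : ℝ)) baseMap (fun _ => 0) := by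
    constructor <;> simp [baseMap]
  let s : ℕ → S := fun n => Nat.rec ⟨(_, _), h₀⟩ (fun n s => next n s) n
  exact ⟨fun n => (s n).1.1, fun n => (s n).1.2, fun n => (s n).2,
    fun n => (hnext n (s n)).1, fun n => (hnext n (s n)).2.1, fun n => (hnext n (s n)).2.2⟩

theorem isOpen_isNear (k : ℕ) {ε : ℝ} (f g : ℕ × Bool → ℝ) (D q : ℝ) :
    IsOpen {t | IsNear k ε t f g D q} := by
  have hfin : {x : ℕ × Bool | x.1 < k}.Finite :=
    ((Set.finite_Iio k).prod (Set.finite_univ (α := Bool))).subset fun x hx => ⟨hx, mem_univ _⟩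
  have h₁ : {t | IsNear k ε t f g D q} =
      (⋂ x ∈ {x : ℕ × Bool | x.1 < k}, {t | |f x - t.1.1 x| < ε ∧ |g x - t.1.2 x| < ε}) ∩
        {t | |D - t.2.1| < ε ∧ |q - t.2.2| < ε} := by
    ext t
    simp [IsNear]
  rw [h₁]
  have h₂ : ∀ (φ : ((ℕ × Bool → ℝ) × (ℕ × Bool → ℝ)) × (ℝ × ℝ) → ℝ) (c : ℝ), Continuous φ →
      IsOpen {t | |c - φ t| < ε} := fun φ c hφ => isOpen_lt (by fun_prop) continuous_const
  exact (hfin.isOpen_biInter fun x _ => (h₂ (fun t => t.1.1 x) _ (by fun_prop)).inter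
    (h₂ (fun t => t.1.2 x) _ (by fun_prop))).inter
    ((h₂ (fun t => t.2.1) _ (by fun_prop)).inter (h₂ (fun t => t.2.2) _ (by fun_prop)))

/-- A countable structure in which every type is approximated on finite sets. -/
theorem exists_countable_structure :
    ∃ (d : ℕ × Bool → ℕ × Bool → ℝ) (p : ℕ × Bool → ℝ), IsRetractStructure d baseMap p ∧
      ∀ f g D q, IsRetractType d baseMap p f g D q → ∀ (k : ℕ) (ε : ℝ), 0 < ε →
        ∃ n, IsNear k ε ((f, g), (D, q)) (d (n, true)) (d (n, false))
          (d (n, true) (n, false)) (p (n, true)) := by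
  -- Stage `n` decodes to a target from a countable dense set, a tolerance and a number of pairs to
  -- control. The number decoded never exceeds `n`, so those pairs are already fixed.
  obtain ⟨d, p, hs, hd, hp, hn⟩ := exists_structure_sequence
    (fun n => denseSeq _ n.unpair.1.unpair.1) (fun n => n.unpair.2)
    (fun n => 1 / ((n.unpair.1.unpair.2 : ℝ) + 1)) (fun n => Nat.unpair_right_le n)
  have hd' : ∀ (x y : ℕ × Bool) (n m : ℕ), x.1 < n → y.1 < n → n ≤ m → d m x y = d n x y := by
    intro x y n m hx hy hnm
    induction m, hnm using Nat.le_induction with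
    | base => rfl
    | succ m hm ih => rw [hd m x y (by omega) (by omega), ih]
  have hp' : ∀ (x : ℕ × Bool) (n m : ℕ), x.1 < n → n ≤ m → p m x = p n x := by
    intro x n m hx hnm
    induction m, hnm using Nat.le_induction with
    | base => rfl
    | succ m hm ih => rw [hp m x (by omega), ih]
  -- The distance between two points is final once both indices are below the stage, so the limit is
  -- read off at the first such stage.
  let d₀ : ℕ × Bool → ℕ × Bool → ℝ := fun x y => d (max x.1 y.1 + 1) x y
  let p₀ : ℕ × Bool → ℝ := fun x => p (x.1 + 1) x
  have hd₀ : ∀ (x y : ℕ × Bool) (n : ℕ), x.1 < n → y.1 < n → d₀ x y = d n x y :=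
    fun x y n hx hy => (hd' x y _ n (by omega) (by omega) (by omega)).symm
  have hp₀ : ∀ (x : ℕ × Bool) (n : ℕ), x.1 < n → p₀ x = p n x :=
    fun x n hx => (hp' x _ n (by omega) (by omega)).symm
  have hb : ∀ x, (baseMap x).1 = x.1 := fun _ => rfl
  refine ⟨d₀, p₀, ?_, ?_⟩
  · constructor
    · intro x
      exact (hs _).self x
    · intro x y
      rw [hd₀ x y (x.1 + y.1 + 1) (by omega) (by omega),
        hd₀ y x (x.1 + y.1 + 1) (by omega) (by omega)]
      exact (hs _).symm x y
    · intro x y z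
      rw [hd₀ x y (x.1 + y.1 + z.1 + 1) (by omega) (by omega),
        hd₀ x z (x.1 + y.1 + z.1 + 1) (by omega) (by omega),
        hd₀ y z (x.1 + y.1 + z.1 + 1) (by omega) (by omega)]
      exact (hs _).tri x y z
    · intro x y
      exact (hs _).lip x y
    · intro x
      rfl
    · intro x y
      rw [hd₀ x y (x.1 + y.1 + 1) (by omega) (by omega), hp₀ x (x.1 + y.1 + 1) (by omega),
        hp₀ y (x.1 + y.1 + 1) (by omega)]
      exact (hs _).height_lip x y
    · intro x
      exact (hs _).height_map x
    · intro x
      rw [hd₀ x (baseMap x) (x.1 + 1) (by omega) (by simp [hb])]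
      exact (hs _).dist_map_le x
  · intro f g D q ht k ε hε
    obtain ⟨m, hm⟩ := exists_nat_one_div_lt (half_pos hε)
    obtain ⟨j, hj⟩ := (denseRange_denseSeq
      (((ℕ × Bool → ℝ) × (ℕ × Bool → ℝ)) × (ℝ × ℝ))).exists_mem_open
        (isOpen_isNear k (ε := 1 / ((m : ℝ) + 1)) f g D q)
        ⟨((f, g), (D, q)), by
          have : (0 : ℝ) < 1 / ((m : ℝ) + 1) := by positivity
          simp only [mem_ofPred_eq, IsNear, sub_self, abs_zero]
          exact ⟨fun _ _ => ⟨this, this⟩, this, this⟩⟩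
    -- At this stage the restriction of the given type is itself a witness near the target, so the
    -- pair added is near the target as well. Both errors are below `ε / 2`.
    let n := Nat.pair (Nat.pair j m) k
    have hkn : k ≤ n := Nat.right_le_pair _ _
    have hpart : IsPartialType n (d n) (p n) f g D q := by
      have := ht.comap (Subtype.val : {x : ℕ × Bool // x.1 < n} → ℕ × Bool)
        (fun x => ⟨baseMap x, x.2⟩) (fun _ => rfl)
      unfold IsPartialType
      convert this using 1
      · ext x y
        exact (hd₀ _ _ _ x.2 y.2).symm
      · ext x
        exact (hp₀ _ _ x.2).symm
    have key := hn n
    simp only [n, Nat.unpair_pair] at key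
    obtain ⟨h₁, h₂, h₃⟩ := key ⟨f, g, D, q, hpart, hj⟩
    obtain ⟨e₁, e₂, e₃⟩ := hj
    refine ⟨n, ⟨fun x hx => ?_, ?_, ?_⟩⟩
    · rw [hd₀ _ _ (n + 1) (by simp) (by omega), hd₀ _ _ (n + 1) (by simp) (by omega)]
      obtain ⟨h₄, h₅⟩ := h₁ x hx
      obtain ⟨e₄, e₅⟩ := e₁ x hx
      simp only [abs_lt] at *
      constructor <;> constructor <;> linarith
    · rw [hd₀ _ _ (n + 1) (by simp) (by simp)]
      simp only [abs_lt] at *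
      constructor <;> linarith
    · rw [hp₀ _ (n + 1) (by simp)]
      simp only [abs_lt] at *
      constructor <;> linarith

end Countable

/-! ### Completion and exact realization of types -/

/-- A complete separable metric space with a retraction and its height function in which all types
are realized on finite sets. -/
structure IsGenericRetraction {M : Type*} [MetricSpace M] (R : M → M) (p : M → ℝ) : Prop where
  complete : CompleteSpace M
  separable : SeparableSpace M
  nonempty : Nonempty M
  isRetractStructure : IsRetractStructure dist R p
  realize : ∀ f g D q, IsRetractType dist R p f g D q → ∀ A : Set M, A.Finite →
    ∃ x, p x = q ∧ dist x (R x) = D ∧ ∀ a ∈ A, dist x a = f a ∧ dist (R x) a = g a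

/-- All types over the structure are approximated on finite sets. -/
def ApproximatesTypes {X : Type*} [PseudoMetricSpace X] (r : X → X) (p : X → ℝ) : Prop :=
  ∀ f g D q, IsRetractType dist r p f g D q → ∀ A : Set X, A.Finite → ∀ ε : ℝ, 0 < ε →
    ∃ x, |p x - q| ≤ ε ∧ |dist x (r x) - D| ≤ ε ∧
      ∀ a ∈ A, |dist x a - f a| ≤ ε ∧ |dist (r x) a - g a| ≤ ε

namespace IsRetractStructure

theorem lipschitzWith {X : Type*} [PseudoMetricSpace X] {r : X → X} {p : X → ℝ}
    (h : IsRetractStructure dist r p) : LipschitzWith 1 r :=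
  LipschitzWith.of_dist_le_mul fun x y => by simpa using h.lip x y

theorem height_lipschitzWith {X : Type*} [PseudoMetricSpace X] {r : X → X} {p : X → ℝ}
    (h : IsRetractStructure dist r p) : LipschitzWith 1 p :=
  LipschitzWith.of_le_add fun x y => h.height_lip x y

/-- Successive approximation: a point with error `(1/2)^n` is followed by one with error
`(1/2)^(n+1)` at distance at most `2 * (1/2)^n`, and the limit has no error. -/
theorem isGenericRetraction {M : Type*} [MetricSpace M] [CompleteSpace M] [SeparableSpace M]
    [Nonempty M] {R : M → M} {p : M → ℝ} (h : IsRetractStructure dist R p)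
    (happ : ApproximatesTypes R p) : IsGenericRetraction R p := by
  refine ⟨inferInstance, inferInstance, inferInstance, h, fun f g D q t A hA => ?_⟩
  obtain ⟨m⟩ := ‹Nonempty M›
  -- Refinement needs a nonempty finite family closed under `R`.
  let B : Set M := (insert m A) ∪ R '' (insert m A)
  have hB : B.Finite := (hA.insert m).union ((hA.insert m).image R)
  have hRB : ∀ x ∈ B, R x ∈ B := by
    rintro x (hx | ⟨y, hy, rfl⟩)
    · exact .inr ⟨x, hx, rfl⟩
    · rw [h.idem]
      exact .inr ⟨y, hy, rfl⟩
  have hAB : A ⊆ B := fun a ha => .inl (.inr ha)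
  have : Finite B := hB
  have : Nonempty B := ⟨⟨m, .inl (.inl rfl)⟩⟩
  let Q : ℕ → M → Prop := fun n x => |p x - q| ≤ (1 / 2) ^ n ∧ |dist x (R x) - D| ≤ (1 / 2) ^ n ∧
      ∀ a ∈ B, |dist x a - f a| ≤ (1 / 2) ^ n ∧ |dist (R x) a - g a| ≤ (1 / 2) ^ n
  have step : ∀ (n : ℕ) (x : {x // Q n x}), ∃ y : {y // Q (n + 1) y},
      dist x.1 y.1 ≤ 2 * (1 / 2) ^ n := by
    rintro n ⟨x, hq, hD, hx⟩
    obtain ⟨f', g', t', hf', hg', hx'⟩ := t.exists_refinement h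
      (z := (Subtype.val : B → M)) (ρ := fun b => ⟨R b, hRB b b.2⟩) (fun _ => rfl) x
      (fun i => (hx i i.2).1) (fun i => (hx i i.2).2) hD hq
    -- Including `x` among the controlled points bounds `dist y x` by `f' x` plus the new error.
    obtain ⟨y, hyq, hyD, hy⟩ := happ f' g' D q t' (insert x B) (hB.insert x) ((1 / 2) ^ (n + 1))
      (by positivity)
    refine ⟨⟨y, hyq, hyD, fun a ha => ?_⟩, ?_⟩
    · rw [← hf' ⟨a, ha⟩, ← hg' ⟨a, ha⟩]
      exact hy a (.inr ha)
    · have h₁ := (abs_le.1 (hy x (.inl rfl)).1).2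
      have h₂ : (1 / 2 : ℝ) ^ (n + 1) ≤ (1 / 2) ^ n :=
        pow_le_pow_of_le_one (by norm_num) (by norm_num) (Nat.le_succ n)
      rw [dist_comm]
      simp only
      linarith
  choose next hnext using step
  obtain ⟨x₀, hx₀⟩ : ∃ x, Q 0 x := by
    obtain ⟨x, h₁, h₂, h₃⟩ := happ f g D q t B hB 1 one_pos
    exact ⟨x, by simpa only [Q, pow_zero] using ⟨h₁, h₂, h₃⟩⟩
  let s : ∀ n, {x // Q n x} := fun n => Nat.rec ⟨x₀, hx₀⟩ (fun n x => next n x) n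
  have hs : CauchySeq fun n => (s n).1 :=
    cauchySeq_of_le_geometric (1 / 2) 2 (by norm_num) fun n => hnext n (s n)
  obtain ⟨y, hy⟩ := cauchySeq_tendsto_of_complete hs
  have hε : Filter.Tendsto (fun n : ℕ => (1 / 2 : ℝ) ^ n) Filter.atTop (nhds 0) :=
    tendsto_pow_atTop_nhds_zero_of_lt_one (by norm_num) (by norm_num)
  have hR := (h.lipschitzWith.continuous.tendsto y).comp hy
  have hlim : ∀ (w : M → ℝ) (c : ℝ), Continuous w → (∀ n, |w (s n).1 - c| ≤ (1 / 2) ^ n) →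
      w y = c := by
    intro w c hw hwc
    have h₁ : |w y - c| ≤ 0 :=
      le_of_tendsto_of_tendsto ((((hw.tendsto y).comp hy).sub_const c).abs) hε
        (Filter.Eventually.of_forall hwc)
    exact sub_eq_zero.1 (abs_nonpos_iff.1 h₁)
  have hRc := h.lipschitzWith.continuous
  exact ⟨y, hlim p q h.height_lipschitzWith.continuous fun n => (s n).2.1,
    hlim _ D (continuous_id.dist hRc) fun n => (s n).2.2.1,
    fun a ha => ⟨hlim _ _ (continuous_id.dist continuous_const) fun n => ((s n).2.2.2 a (hAB ha)).1,
      hlim _ _ (hRc.dist continuous_const) fun n => ((s n).2.2.2 a (hAB ha)).2⟩⟩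

-- The structure axioms are closed conditions, so they pass from the dense image to the Hausdorff
-- completion. A type over the completion restricts to `X`. As both functions of a type are
-- 1-Lipschitz, moving each control point by less than `ε / 3` changes the two compared quantities
-- by less than `ε / 3` each.
open UniformSpace in
theorem exists_completion {X : Type*} [PseudoMetricSpace X] [Countable X] [Nonempty X]
    {r : X → X} {p : X → ℝ} (h : IsRetractStructure dist r p) (happ : ApproximatesTypes r p) :
    ∃ (R : Completion X → Completion X) (P : Completion X → ℝ), IsGenericRetraction R P := by
  have hr := h.lipschitzWith
  have hp := h.height_lipschitzWith
  let R : Completion X → Completion X := Completion.map r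
  let P : Completion X → ℝ := Completion.extension p
  have hRc : Continuous R := Completion.continuous_map
  have hPc : Continuous P := Completion.continuous_extension
  have hR : ∀ x : X, R x = r x := Completion.map_coe hr.uniformContinuous
  have hP : ∀ x : X, P x = p x := Completion.extension_coe hp.uniformContinuous
  have hstr : IsRetractStructure dist R P :=
    { self := dist_self
      symm := dist_comm
      tri := dist_triangle
      lip := fun x y => by simpa using hr.completion_map.dist_le_mul x y
      idem := fun x => Completion.induction_on x (isClosed_eq (hRc.comp hRc) hRc) fun a => by
        rw [hR, hR, h.idem]
      height_lip := fun x y => Completion.induction_on₂ x y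
        (isClosed_le (by fun_prop) (by fun_prop)) fun a b => by
          rw [hP, hP, Completion.dist_eq]
          exact h.height_lip a b
      height_map := fun x => Completion.induction_on x
        (isClosed_eq (hPc.comp hRc) continuous_const) fun a => by
          rw [hR, hP, h.height_map]
      dist_map_le := fun x => Completion.induction_on x
        (isClosed_le (by fun_prop) (by fun_prop)) fun a => by
          rw [hR, hP, Completion.dist_eq]
          exact h.dist_map_le a }
  have : Nonempty (Completion X) := ‹Nonempty X›.map (↑)
  refine ⟨R, P, hstr.isGenericRetraction fun f g D q t A hA ε hε => ?_⟩
  have t' : IsRetractType dist r p (fun x : X => f x) (fun x : X => g x) D q := by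
    have := t.comap ((↑) : X → Completion X) r (fun x => (hR x).symm)
    simpa only [hP, Completion.dist_eq] using this
  have hdense : ∀ a : Completion X, ∃ x : X, dist a x < ε / 3 := fun a =>
    Completion.denseRange_coe.exists_dist_lt a (by linarith)
  choose c hc using hdense
  obtain ⟨x, hxq, hxD, hx⟩ := happ _ _ D q t' (c '' A) (hA.image c) (ε / 3) (by linarith)
  refine ⟨x, ?_, ?_, fun a ha => ?_⟩
  · rw [hP]
    linarith
  · rw [hR, Completion.dist_eq]
    linarith
  · obtain ⟨h₁, h₂⟩ := hx (c a) ⟨a, ha, rfl⟩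
    have hca := (hc a).le
    rw [hR]
    rw [← Completion.dist_eq] at h₁ h₂
    rw [abs_le] at *
    have hca' := dist_comm a (c a)
    refine ⟨⟨?_, ?_⟩, abs_le.2 ⟨?_, ?_⟩⟩ <;>
      linarith [t.f_lip a (c a), t.f_lip (c a) a, t.g_lip a (c a), t.g_lip (c a) a,
        dist_triangle (x : Completion X) a (c a), dist_triangle (x : Completion X) (c a) a,
        dist_triangle (r x : Completion X) a (c a), dist_triangle (r x : Completion X) (c a) a]

end IsRetractStructure

theorem exists_isGenericRetraction :
    ∃ (M : Type) (_ : MetricSpace M) (R : M → M) (p : M → ℝ), IsGenericRetraction R p := by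
  obtain ⟨d, p, h, happ⟩ := exists_countable_structure
  let I : PseudoMetricSpace (ℕ × Bool) :=
    { dist := d
      dist_self := h.self
      dist_comm := h.symm
      dist_triangle := h.tri }
  obtain ⟨R, P, hRP⟩ := @IsRetractStructure.exists_completion (ℕ × Bool) I _ _ baseMap p h (by
    intro f g D q t A hA ε hε
    obtain ⟨k, hk⟩ : ∃ k, ∀ a ∈ A, a.1 < k := by
      obtain ⟨k, hk⟩ := (hA.image Prod.fst).bddAbove
      exact ⟨k + 1, fun a ha => Nat.lt_succ_of_le (hk ⟨a, ha, rfl⟩)⟩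
    obtain ⟨n, h₁, h₂, h₃⟩ := happ f g D q t k ε hε
    exact ⟨(n, true), h₃.le, h₂.le, fun a ha => ⟨(h₁ a (hk a ha)).1.le, (h₁ a (hk a ha)).2.le⟩⟩)
  exact ⟨_, _, R, P, hRP⟩

/-! ### Back-and-forth for partial isometries -/

section BackAndForth

variable {X : Type*} {Y : Type*}

theorem exists_chain {P : Set (X × Y) → Prop} {task : ℕ → Set (X × Y) → Prop}
    (h : ∀ n s, P s → ∃ t, s ⊆ t ∧ P t ∧ task n t) {s : Set (X × Y)} (hs : P s) :
    ∃ c : ℕ → Set (X × Y), Monotone c ∧ c 0 = s ∧ (∀ n, P (c n)) ∧ ∀ n, task n (c (n + 1)) := by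
  have step : ∀ (n : ℕ) (s : {s // P s}), ∃ t : {t // P t}, s.1 ⊆ t.1 ∧ task n t.1 := by
    rintro n ⟨s, hs⟩
    obtain ⟨t, h₁, h₂, h₃⟩ := h n s hs
    exact ⟨⟨t, h₂⟩, h₁, h₃⟩
  choose next h₁ h₂ using step
  let c : ℕ → {s // P s} := fun n => Nat.rec ⟨s, hs⟩ (fun n s => next n s) n
  exact ⟨fun n => (c n).1, monotone_nat_of_le_succ fun n => h₁ n (c n), rfl, fun n => (c n).2,
    fun n => h₂ n (c n)⟩

variable [MetricSpace X] [MetricSpace Y]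

/-- The pairs in `s` form a partial isometry. -/
def IsPartialIsometry (s : Set (X × Y)) : Prop :=
  ∀ z ∈ s, ∀ w ∈ s, dist z.1 w.1 = dist z.2 w.2

theorem IsPartialIsometry.exists_isometry [CompleteSpace Y] {T : Set (X × Y)}
    (hT : IsPartialIsometry T) (hd : Dense (Prod.fst '' T)) :
    ∃ i : X → Y, Isometry i ∧ ∀ z ∈ T, i z.1 = z.2 := by
  have hex : ∀ x : Prod.fst '' T, ∃ y, (x.1, y) ∈ T := by
    rintro ⟨_, ⟨x, y⟩, h, rfl⟩
    exact ⟨y, h⟩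
  choose f hf using hex
  have hfi : Isometry f := Isometry.of_dist_eq fun x y => (hT _ (hf x) _ (hf y)).symm
  have hfu := hfi.uniformContinuous
  have hext : ∀ x : Prod.fst '' T, hd.extend f x = f x := hd.extend_of_ind hfu
  have hc : Continuous (hd.extend f) := (hd.uniformContinuous_extend hfu).continuous
  refine ⟨hd.extend f, Isometry.of_dist_eq ?_, fun z hz => ?_⟩
  · intro x y
    have hcl : IsClosed {w : X × X | dist (hd.extend f w.1) (hd.extend f w.2) = dist w.1 w.2} :=
      isClosed_eq (by fun_prop) (by fun_prop)
    have hsub : (Prod.fst '' T) ×ˢ (Prod.fst '' T) ⊆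
        {w : X × X | dist (hd.extend f w.1) (hd.extend f w.2) = dist w.1 w.2} := by
      rintro ⟨a, b⟩ ⟨ha, hb⟩
      have h₁ := hext ⟨a, ha⟩
      have h₂ := hext ⟨b, hb⟩
      simp only at h₁ h₂
      change dist (hd.extend f a) (hd.extend f b) = dist a b
      rw [h₁, h₂, hfi.dist_eq]
      rfl
    exact hcl.closure_subset_iff.2 hsub ((hd.prod hd) (x, y))
  · have hz' : z.1 ∈ Prod.fst '' T := ⟨z, hz, rfl⟩
    have h₁ := hext ⟨z.1, hz'⟩
    simp only at h₁
    rw [h₁, ← dist_eq_zero, ← hT (z.1, f ⟨z.1, hz'⟩) (hf ⟨z.1, hz'⟩) z hz, dist_self]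

theorem isPartialIsometry_iUnion {c : ℕ → Set (X × Y)} (hc : Monotone c)
    (h : ∀ n, IsPartialIsometry (c n)) : IsPartialIsometry (⋃ n, c n) := by
  intro z hz w hw
  obtain ⟨n, hn⟩ := mem_iUnion.1 hz
  obtain ⟨m, hm⟩ := mem_iUnion.1 hw
  exact h (max n m) z (hc (le_max_left _ _) hn) w (hc (le_max_right _ _) hm)

/-- A family of partial isometries with the forth property yields an isometric embedding that is
locally a member of the family on a dense set. -/
theorem exists_isometry_of_forth [SeparableSpace X] [CompleteSpace Y]
    {P : Set (X × Y) → Prop} (hP : ∀ s, P s → IsPartialIsometry s)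
    (forth : ∀ s, P s → ∀ x, ∃ t, s ⊆ t ∧ P t ∧ x ∈ Prod.fst '' t)
    {s : Set (X × Y)} (hs : P s) :
    ∃ i : X → Y, Isometry i ∧ ∃ T : Set (X × Y), (∀ z ∈ T, ∃ t ⊆ T, P t ∧ z ∈ t) ∧
      Dense (Prod.fst '' T) ∧ ∀ z ∈ T, i z.1 = z.2 := by
  rcases isEmpty_or_nonempty X with hX | hX
  · exact ⟨isEmptyElim, fun x => isEmptyElim x, ∅, by simp, fun x => isEmptyElim x, by simp⟩
  obtain ⟨c, hc, -, hcP, htask⟩ := exists_chain (P := P)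
    (task := fun n t => denseSeq X n ∈ Prod.fst '' t) (fun n s hs => forth s hs _) hs
  have hT := isPartialIsometry_iUnion hc fun n => hP _ (hcP n)
  have hd : Dense (Prod.fst '' ⋃ n, c n) := by
    refine (denseRange_denseSeq X).mono ?_
    rintro _ ⟨n, rfl⟩
    exact image_mono (subset_iUnion c (n + 1)) (htask n)
  obtain ⟨i, hi, hiT⟩ := hT.exists_isometry hd
  refine ⟨i, hi, ⋃ n, c n, fun z hz => ?_, hd, hiT⟩
  obtain ⟨n, hn⟩ := mem_iUnion.1 hz
  exact ⟨c n, subset_iUnion c n, hcP n, hn⟩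

/-- A family of partial isometries with the back-and-forth property yields a surjective isometry
that is locally a member of the family on a dense set. -/
theorem exists_isometryEquiv_of_back_and_forth [SeparableSpace X] [SeparableSpace Y]
    [CompleteSpace X] [CompleteSpace Y] [Nonempty X] [Nonempty Y]
    {P : Set (X × Y) → Prop} (hP : ∀ s, P s → IsPartialIsometry s)
    (forth : ∀ s, P s → ∀ x, ∃ t, s ⊆ t ∧ P t ∧ x ∈ Prod.fst '' t)
    (back : ∀ s, P s → ∀ y, ∃ t, s ⊆ t ∧ P t ∧ y ∈ Prod.snd '' t)
    {s : Set (X × Y)} (hs : P s) :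
    ∃ (i : X ≃ᵢ Y) (T : Set (X × Y)), s ⊆ T ∧ (∀ z ∈ T, ∃ t ⊆ T, P t ∧ z ∈ t) ∧
      Dense (Prod.fst '' T) ∧ ∀ z ∈ T, i z.1 = z.2 := by
  obtain ⟨c, hc, hc₀, hcP, htask⟩ := exists_chain (P := P)
    (task := fun n t => denseSeq X n ∈ Prod.fst '' t ∧ denseSeq Y n ∈ Prod.snd '' t)
    (fun n s hs => by
      obtain ⟨t, h₁, h₂, h₃⟩ := forth s hs (denseSeq X n)
      obtain ⟨t', h₄, h₅, h₆⟩ := back t h₂ (denseSeq Y n)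
      exact ⟨t', h₁.trans h₄, h₅, image_mono h₄ h₃, h₆⟩) hs
  have hT := isPartialIsometry_iUnion hc fun n => hP _ (hcP n)
  have hd : Dense (Prod.fst '' ⋃ n, c n) := by
    refine (denseRange_denseSeq X).mono ?_
    rintro _ ⟨n, rfl⟩
    exact image_mono (subset_iUnion c (n + 1)) (htask n).1
  obtain ⟨i, hi, hiT⟩ := hT.exists_isometry hd
  have hrange : DenseRange i := by
    refine (denseRange_denseSeq Y).mono ?_
    rintro _ ⟨n, rfl⟩
    obtain ⟨z, hz, hzn⟩ := (htask n).2
    exact ⟨z.1, by rw [hiT z (mem_iUnion.2 ⟨_, hz⟩), hzn]⟩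
  have hsurj : Function.Surjective i := by
    rw [← range_eq_univ, ← hi.isClosedEmbedding.isClosed_range.closure_eq, hrange.closure_range]
  refine ⟨⟨Equiv.ofBijective i ⟨hi.injective, hsurj⟩, hi⟩, ⋃ n, c n, ?_, fun z hz => ?_, hd, hiT⟩
  · rw [← hc₀]
    exact subset_iUnion c 0
  · obtain ⟨n, hn⟩ := mem_iUnion.1 hz
    exact ⟨c n, subset_iUnion c n, hcP n, hn⟩

theorem IsPartialIsometry.swap {s : Set (X × Y)} (h : IsPartialIsometry s) :
    IsPartialIsometry (Prod.swap '' s) := by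
  rintro _ ⟨z, hz, rfl⟩ _ ⟨w, hw, rfl⟩
  exact (h z hz w hw).symm

end BackAndForth

/-! ### Uniqueness of the Urysohn space -/

namespace IsUrysohnSpace

variable {U : Type u} {V : Type v} [MetricSpace U] [MetricSpace V]

theorem nonempty (h : IsUrysohnSpace U) : Nonempty U :=
  let ⟨x, _⟩ := h.one_point_extension ∅ (fun _ => 0) finite_empty (by simp)
  ⟨x⟩

theorem exists_extension (hV : IsUrysohnSpace V) {s : Set (U × V)} (hs : s.Finite)
    (hi : IsPartialIsometry s) (x : U) :
    ∃ t, s ⊆ t ∧ (t.Finite ∧ IsPartialIsometry t) ∧ x ∈ Prod.fst '' t := by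
  classical
  -- The chosen preimage does not matter: in a partial isometry the second coordinate determines the
  -- first.
  let f : V → ℝ := fun b => if h : ∃ a, (a, b) ∈ s then dist x h.choose else 0
  have hf : ∀ z ∈ s, f z.2 = dist x z.1 := by
    intro z hz
    have h : ∃ a, (a, z.2) ∈ s := ⟨z.1, hz⟩
    have h₁ : h.choose = z.1 := by
      rw [← dist_eq_zero, hi _ h.choose_spec z hz, dist_self]
    simp only [f, dif_pos h, h₁]
  obtain ⟨y, hy⟩ := hV.one_point_extension (Prod.snd '' s) f (hs.image _) (by
    rintro _ ⟨z, hz, rfl⟩ _ ⟨w, hw, rfl⟩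
    rw [hf z hz, hf w hw, ← hi z hz w hw, abs_le]
    refine ⟨⟨?_, ?_⟩, dist_triangle_left _ _ _⟩
    · linarith [dist_triangle x z.1 w.1]
    · linarith [dist_triangle x w.1 z.1, dist_comm w.1 z.1])
  have hy' : ∀ z ∈ s, dist x z.1 = dist y z.2 := fun z hz => by
    rw [hy _ ⟨z, hz, rfl⟩, hf z hz]
  refine ⟨insert (x, y) s, subset_insert _ _, ⟨hs.insert _, ?_⟩, (x, y), mem_insert _ _, rfl⟩
  rintro z (rfl | hz) w (rfl | hw)
  · simp
  · exact hy' w hw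
  · rw [dist_comm, dist_comm z.2]
    exact hy' z hz
  · exact hi z hz w hw

/-- The Urysohn space is unique up to isometry. -/
theorem nonempty_isometryEquiv (hU : IsUrysohnSpace U) (hV : IsUrysohnSpace V) :
    Nonempty (U ≃ᵢ V) := by
  have := hU.complete
  have := hV.complete
  have := hU.separable
  have := hV.separable
  have := hU.nonempty
  have := hV.nonempty
  obtain ⟨i, -⟩ := exists_isometryEquiv_of_back_and_forth
    (P := fun s : Set (U × V) => s.Finite ∧ IsPartialIsometry s) (fun s hs => hs.2)
    (fun s hs x => hV.exists_extension hs.1 hs.2 x)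
    (fun s hs y => by
      obtain ⟨t, h₁, h₂, z, hz, rfl⟩ := hU.exists_extension (hs.1.image Prod.swap) hs.2.swap y
      refine ⟨Prod.swap '' t, fun w hw => ⟨w.swap, h₁ ⟨w, hw, rfl⟩, w.swap_swap⟩,
        ⟨h₂.1.image _, h₂.2.swap⟩, z.swap, ⟨z, hz, rfl⟩, rfl⟩)
    (s := ∅) ⟨finite_empty, fun z hz => hz.elim⟩
  exact ⟨i⟩

end IsUrysohnSpace

/-! ### Consequences of genericity -/

/-- A finite partial isomorphism of metric spaces with retractions and height functions. -/
structure IsPartialIso {X Y : Type*} [MetricSpace X] [MetricSpace Y] (r : X → X) (p : X → ℝ)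
    (R : Y → Y) (P : Y → ℝ) (s : Set (X × Y)) : Prop where
  finite : s.Finite
  isometric : IsPartialIsometry s
  map : ∀ z ∈ s, (r z.1, R z.2) ∈ s
  height : ∀ z ∈ s, p z.1 = P z.2

theorem IsPartialIso.swap {X Y : Type*} [MetricSpace X] [MetricSpace Y] {r : X → X} {p : X → ℝ}
    {R : Y → Y} {P : Y → ℝ} {s : Set (X × Y)} (h : IsPartialIso r p R P s) :
    IsPartialIso R P r p (Prod.swap '' s) where
  finite := h.finite.image _
  isometric := h.isometric.swap
  map := by
    rintro _ ⟨z, hz, rfl⟩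
    exact ⟨_, h.map z hz, rfl⟩
  height := by
    rintro _ ⟨z, hz, rfl⟩
    exact (h.height z hz).symm

namespace IsGenericRetraction

variable {M : Type*} [MetricSpace M] {R : M → M} {P : M → ℝ}

/-- A generator indexed by a finite (possibly empty) type is realized. -/
theorem exists_realization (h : IsGenericRetraction R P) {ι : Type*} [Finite ι] {z : ι → M}
    {ρ : ι → ι} {u v : ι → ℝ} {D q : ℝ} (t : IsGenerator dist P R z ρ u v D q) :
    ∃ x, P x = q ∧ dist x (R x) = D ∧
      (∀ i, (∀ j, u i ≤ u j + dist (z j) (z i)) → dist x (z i) = u i) ∧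
      (∀ i, (∀ j, v i ≤ v j + dist (z j) (z i)) → dist (R x) (z i) = v i) := by
  have hs := h.isRetractStructure
  cases isEmpty_or_nonempty ι
  · obtain ⟨m⟩ := h.nonempty
    have hqD := t.q_le
    have hDq := t.le_q
    -- An empty family imposes no bounds, so a fixed point `R m` is added as an anchor at distance
    -- `D` from both new points.
    have t' : IsGenerator dist P R (fun _ : Unit => R m) id (fun _ => D) (fun _ => D) D q := by
      have h₁ := dist_self (R m)
      have h₂ := hs.height_map m
      constructor
      · exact fun _ => (hs.idem m).symm
      all_goals
        intros
        linarith
    obtain ⟨x, hq, hD, -⟩ := h.realize _ _ D q (t'.isRetractType hs) ∅ finite_empty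
    exact ⟨x, hq, hD, fun i => isEmptyElim i, fun i => isEmptyElim i⟩
  · obtain ⟨x, hq, hD, hx⟩ := h.realize _ _ D q (t.isRetractType hs) (range z) (finite_range z)
    exact ⟨x, hq, hD, fun i hi => by rw [(hx _ ⟨i, rfl⟩).1, minExt_apply hs z u i hi],
      fun i hi => by rw [(hx _ ⟨i, rfl⟩).2, minExt_apply hs z v i hi]⟩

theorem isLipschitzRetraction (h : IsGenericRetraction R P) :
    IsLipschitzRetraction R {x | R x = x} :=
  ⟨h.isRetractStructure.lipschitzWith, h.isRetractStructure.idem, fun _ hx => hx⟩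

/-- The lower bound on the distance is the Lipschitz property of the height. For the upper bound,
genericity supplies a fixed point at distance exactly `P x` from `x`. -/
theorem height_eq_infDist (h : IsGenericRetraction R P) (x : M) :
    P x = infDist x {x | R x = x} := by
  have hs := h.isRetractStructure
  apply le_antisymm
  · refine (le_infDist (s := {x | R x = x}) ⟨R x, hs.idem x⟩).2 fun y hy => ?_
    have := hs.height_le_dist_map x y
    rwa [show R y = y from hy] at this
  · have hp := hs.height_nonneg x
    -- `D = 0` forces the realized point to be fixed. Placing it at distance `P x` from both `x` and
    -- `R x` is consistent because `dist x (R x) ≤ 2 * P x`.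
    have t : IsGenerator dist P R (fun b : Bool => if b then x else R x) (fun _ => false)
        (fun _ => P x) (fun _ => P x) 0 0 := by
      constructor
      · rintro (_ | _) <;> simp [hs.idem]
      any_goals
        rintro (_ | _) (_ | _) <;> simp only [if_true, Bool.false_eq_true, if_false] <;>
        linarith [hs.dist_map_le x, dist_comm x (R x), dist_self x, dist_self (R x),
          dist_nonneg (x := x) (y := R x)]
      any_goals
        rintro (_ | _) <;> simp only [if_true, Bool.false_eq_true, if_false] <;>
        linarith [hs.height_map x]
      all_goals intros; linarith
    obtain ⟨y, -, hy, hy', -⟩ := h.exists_realization t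
    have hyx : dist y x = P x := hy' true fun j => by simp
    rw [← hyx, dist_comm]
    exact infDist_le_dist_of_mem (dist_eq_zero.1 hy).symm

theorem fixedPoints_ssubset_univ (h : IsGenericRetraction R P) : {x | R x = x} ⊂ univ := by
  have t : IsGenerator dist P R (fun e : Empty => e.elim) id (fun _ => 0) (fun _ => 0) 1 1 := by
    constructor <;> simp
  obtain ⟨x, -, hx, -⟩ := h.exists_realization t
  refine ssubset_univ_iff.2 fun hu => ?_
  have hx' : R x = x := by
    have : x ∈ {x | R x = x} := hu ▸ mem_univ x
    exact this
  rw [hx', dist_self] at hx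
  exact zero_ne_one hx

theorem isUrysohnSpace_fixedPoints (h : IsGenericRetraction R P) :
    IsUrysohnSpace {x | R x = x} := by
  have hs := h.isRetractStructure
  have := h.complete
  have := h.separable
  have : SecondCountableTopology M := UniformSpace.secondCountable_of_separable M
  have hcl : IsClosed {x | R x = x} := isClosed_eq hs.lipschitzWith.continuous continuous_id
  refine ⟨hcl.completeSpace_coe, inferInstance, fun A f hA hf => ?_⟩
  have : Finite A := hA
  have t : IsGenerator dist P R (fun a : A => (a.1.1 : M)) id (fun a => f a) (fun a => f a) 0 0 := by
    have hfA : ∀ a : A, 0 ≤ f a := fun a => by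
      have := (hf a a.2 a a.2).2
      rw [dist_self] at this
      linarith
    have hP : ∀ a : A, P a.1.1 = 0 := fun a => by
      have := hs.height_map a.1.1
      rwa [show R a.1.1 = a.1.1 from a.1.2] at this
    have h₂ : ∀ a b : A, dist a.1.1 b.1.1 ≤ f a + f b := fun a b => (hf a a.2 b b.2).2
    exact
      { map := fun i => i.1.2.symm
        u_tri := h₂
        v_tri := h₂
        v_map_le_u := fun _ => le_rfl
        v_map_le_v := fun _ => le_rfl
        height_le := fun i => by linarith [hfA i, hP i]
        le_height := fun i => by linarith [hfA i, hP i]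
        le_v := fun i => by linarith [hfA i, hP i]
        u_le := fun i => by simp
        v_le := fun i => by simp
        le_add := fun i j => by linarith [hfA i, hfA j, dist_nonneg (x := i.1.1) (y := j.1.1)]
        q_le := le_rfl
        le_q := by simp }
  obtain ⟨x, -, hx, hxA, -⟩ := h.exists_realization t
  refine ⟨⟨x, (dist_eq_zero.1 hx).symm⟩, fun a ha => hxA ⟨a, ha⟩ fun b => ?_⟩
  have h₁ : f a - f b ≤ dist a b.1 := (abs_le.1 (hf a ha b b.2).1).2
  rw [dist_comm] at h₁
  change f a ≤ f b + dist b.1 a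
  linarith

/-- Only distances to `A` are prescribed, and `A` need not be closed under `R`. A height, a
displacement and distances to `R '' A` must be chosen so that they form a generator that still takes
the value `f a` at each `a`. -/
theorem isUrysohnSpace (h : IsGenericRetraction R P) : IsUrysohnSpace M := by
  have hs := h.isRetractStructure
  refine ⟨h.complete, h.separable, fun A f hA hf => ?_⟩
  have hAf : Finite A := hA
  rcases A.eq_empty_or_nonempty with rfl | hne
  · obtain ⟨m⟩ := h.nonempty
    exact ⟨m, by simp⟩
  have : Nonempty A := hne.to_subtype
  have hlip : ∀ a b : A, f a ≤ f b + dist (a : M) b := fun a b => by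
    linarith [(abs_le.1 (hf a a.2 b b.2).1).2]
  have htri : ∀ a b : A, dist (a : M) b ≤ f a + f b := fun a b => (hf a a.2 b b.2).2
  have hfA : ∀ a : A, 0 ≤ f a := fun a => by
    have := htri a a
    rw [dist_self] at this
    linarith
  obtain ⟨c, hc⟩ := Finite.exists_min fun a : A => P a + f a
  obtain ⟨⟨a₀, b₀⟩, hab⟩ := Finite.exists_min fun w : A × A => f w.1 + f w.2 + dist w.1.1 (R w.2)
  replace hab : ∀ a b : A, f a₀ + f b₀ + dist a₀.1 (R b₀) ≤ f a + f b + dist a.1 (R b) :=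
    fun a b => hab (a, b)
  -- Both `q` and `D` are taken as large as the constraints permit: the height bounds `P a + f a`
  -- for `q`, then `2 * q` and the paths from the new point through some `a` and `R b` to its image
  -- for `D`. A large `D` is what makes the bounds `f a + D` at `R a` compatible with `f`.
  obtain ⟨q, hq⟩ : ∃ q, q = P c + f c := ⟨_, rfl⟩
  obtain ⟨D, hD⟩ : ∃ D, D = min (2 * q) (f a₀ + f b₀ + dist a₀.1 (R b₀)) := ⟨_, rfl⟩
  have hq_le : ∀ a : A, q ≤ P a + f a := fun a => hq ▸ hc a
  have hle_q : ∀ a : A, P a ≤ q + f a := fun a => by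
    linarith [hs.height_lip a c, htri a c]
  have hDq : D ≤ 2 * q := hD ▸ min_le_left _ _
  have hDab : ∀ a b : A, D ≤ f a + f b + dist a.1 (R b) := fun a b =>
    hD ▸ (min_le_right _ _).trans (hab a b)
  have hPc := hs.height_nonneg c
  have hqD : q ≤ D := by
    rw [hD]
    refine le_min ?_ ?_
    · linarith [hfA c]
    · linarith [hq_le a₀, hs.height_le_dist_map a₀ b₀, hfA b₀]
  have hD₀ : 0 ≤ D := by linarith
  have hd : ∀ a b : A, dist a.1 (R b) ≤ f a + f b + D := fun a b => by
    have h₁ := dist_triangle4 a.1 c (R c) (R b)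
    have h₂ := dist_triangle4 a.1 a₀ (R b₀) (R b)
    have := hs.dist_map_le c
    have := hs.lip c b
    have := hs.lip b₀ b
    -- If `D = 2 * q`, the path through `c` and `R c` suffices; otherwise the path through the
    -- minimizing `a₀` and `R b₀` does.
    rcases min_choice (2 * q) (f a₀ + f b₀ + dist a₀.1 (R b₀)) with hm | hm <;>
      rw [hD, hm] <;> linarith [htri a c, htri c b, htri a a₀, htri b₀ b]
  have hlip' : ∀ a b : A, f a ≤ f b + D + dist (R b) a := fun a b => by
    have h₁ := dist_triangle4 (c : M) (R c) (R b) a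
    have h₂ := dist_triangle4 (a₀ : M) (R b₀) (R b) a
    have := hs.dist_map_le c
    have := hs.lip c b
    have := hs.lip b₀ b
    have := dist_comm (c : M) a
    have := dist_comm (a₀ : M) a
    rcases min_choice (2 * q) (f a₀ + f b₀ + dist a₀.1 (R b₀)) with hm | hm <;>
      rw [hD, hm] <;> linarith [htri c b, htri b₀ b, hlip a c, hlip a a₀]
  have hRR : ∀ a b : A, dist (R a) (R b) ≤ f a + f b := fun a b =>
    (hs.lip a b).trans (htri a b)
  have t : IsGenerator dist P R (fun i : A × Bool => if i.2 then (i.1 : M) else R i.1)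
      (fun i => (i.1, false)) (fun i => if i.2 then f i.1 else f i.1 + D)
      (fun i => if i.2 then f i.1 + D else f i.1) D q := by
    constructor
    any_goals
      rintro ⟨a, _ | _⟩ ⟨b, _ | _⟩ <;> simp only [if_true, Bool.false_eq_true, if_false] <;>
      linarith [htri a b, hd a b, hd b a, hRR a b, dist_comm (R a) b, hfA a, hfA b, hDab a b,
        dist_nonneg (x := (a : M)) (y := b), dist_nonneg (x := R a) (y := R b),
        dist_nonneg (x := R a) (y := b)]
    · rintro ⟨a, _ | _⟩ <;> simp [hs.idem]
    any_goals
      rintro ⟨a, _ | _⟩ <;> simp only [if_true, Bool.false_eq_true, if_false] <;>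
      linarith [hfA a, hq_le a, hle_q a, hs.height_map a.1]
    · exact hqD
    · exact hDq
  obtain ⟨x, -, -, hx, -⟩ := h.exists_realization t
  refine ⟨x, fun a ha => ?_⟩
  have := hx (⟨a, ha⟩, true) (by
    rintro ⟨b, _ | _⟩ <;> simp only [if_true, Bool.false_eq_true, if_false]
    · exact hlip' ⟨a, ha⟩ b
    · rw [dist_comm]
      exact hlip ⟨a, ha⟩ b)
  simpa using this

theorem ofIsometryEquiv (h : IsGenericRetraction R P) {U : Type*} [MetricSpace U] (e : M ≃ᵢ U) :
    IsGenericRetraction (fun x => e (R (e.symm x))) (fun x => P (e.symm x)) := by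
  have hs := h.isRetractStructure
  refine ⟨?_, ?_, h.nonempty.map e, ?_, fun f g D q t A hA => ?_⟩
  · have := h.complete
    exact e.symm.completeSpace
  · have := h.separable
    exact e.surjective.denseRange.separableSpace e.continuous
  · have := hs.comap e.symm (fun x => e (R (e.symm x))) (by simp) (by simp [hs.idem])
    simpa only [e.symm.dist_eq] using this
  · have t' := t.comap e R (by simp)
    simp only [e.dist_eq, e.symm_apply_apply] at t'
    obtain ⟨x, hq, hD, hx⟩ := h.realize _ _ D q t' (e ⁻¹' A)
      (hA.preimage e.injective.injOn)
    refine ⟨e x, by simpa using hq, by simpa [e.dist_eq] using hD, fun a ha => ?_⟩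
    have := hx (e.symm a) (by simpa using ha)
    simpa [← e.dist_eq] using this

section PartialIso

variable {X : Type*} [MetricSpace X] {r : X → X} {p : X → ℝ}

/-- The distances from `x` and `r x` to the domain of `s`, moved to its image, form a generator.
Adding both `x` and `r x` keeps the relation closed under the retractions. -/
theorem exists_extension (h : IsGenericRetraction R P) (hr : IsRetractStructure dist r p)
    {s : Set (X × M)} (hs : IsPartialIso r p R P s) (x : X) :
    ∃ t, s ⊆ t ∧ IsPartialIso r p R P t ∧ x ∈ Prod.fst '' t := by
  have hR := h.isRetractStructure
  have : Finite s := hs.finite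
  have hx := hr.height_lip x (r x)
  have hiso : ∀ i j : s, dist i.1.2 j.1.2 = dist i.1.1 j.1.1 := fun i j =>
    (hs.isometric i i.2 j j.2).symm
  have g : IsGenerator dist P R (fun i : s => i.1.2) (fun i => ⟨_, hs.map i.1 i.2⟩)
      (fun i => dist x i.1.1) (fun i => dist (r x) i.1.1) (dist x (r x)) (p x) :=
    { map := fun i => rfl
      u_tri := fun i j => by
        rw [hiso]
        exact dist_triangle_left _ _ _
      v_tri := fun i j => by
        rw [hiso]
        exact dist_triangle_left _ _ _
      v_map_le_u := fun i => hr.lip _ _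
      v_map_le_v := fun i => by simpa only [hr.idem] using hr.lip (r x) i.1.1
      height_le := fun i => by
        rw [← hs.height i i.2]
        exact hr.height_lip _ _
      le_height := fun i => by
        rw [← hs.height i i.2, dist_comm]
        exact hr.height_lip _ _
      le_v := fun i => by
        rw [← hs.height i i.2, dist_comm]
        exact hr.height_le_dist_map _ _
      u_le := fun i => by linarith [dist_triangle x (r x) i.1.1]
      v_le := fun i => by linarith [dist_triangle_left (r x) i.1.1 x]
      le_add := fun i j => by
        rw [hiso]
        linarith [dist_triangle4 x i.1.1 j.1.1 (r x), dist_comm (r x) j.1.1]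
      q_le := by simpa only [hr.height_map, zero_add] using hx
      le_q := hr.dist_map_le x }
  obtain ⟨y, hq, hD, hu, hv⟩ := h.exists_realization g
  replace hu : ∀ z ∈ s, dist x z.1 = dist y z.2 := fun z hz => (hu ⟨z, hz⟩ fun j => by
    rw [hiso]
    exact dist_triangle _ _ _).symm
  replace hv : ∀ z ∈ s, dist (r x) z.1 = dist (R y) z.2 := fun z hz => (hv ⟨z, hz⟩ fun j => by
    rw [hiso]
    exact dist_triangle _ _ _).symm
  refine ⟨insert (x, y) (insert (r x, R y) s), (subset_insert _ _).trans (subset_insert _ _),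
    ⟨(hs.finite.insert _).insert _, ?_, ?_, ?_⟩, (x, y), mem_insert _ _, rfl⟩
  · rintro z (rfl | rfl | hz) w (rfl | rfl | hw)
    · simp
    · exact hD.symm
    · exact hu w hw
    · simpa only [dist_comm] using hD.symm
    · simp
    · exact hv w hw
    · simpa only [dist_comm] using hu z hz
    · simpa only [dist_comm] using hv z hz
    · exact hs.isometric z hz w hw
  · rintro z (rfl | rfl | hz)
    · exact .inr (.inl rfl)
    · simp only [hr.idem, hR.idem]
      exact .inr (.inl rfl)
    · exact .inr (.inr (hs.map z hz))
  · rintro z (rfl | rfl | hz)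
    · exact hq.symm
    · simp only [hr.height_map, hR.height_map]
    · exact hs.height z hz

/-- Both identities hold on the dense set, where `i` locally agrees with partial isomorphisms, and
extend by continuity. -/
theorem commutes_of_dense (h : IsGenericRetraction R P) (hr : IsRetractStructure dist r p)
    {i : X → M} (hi : Isometry i) {T : Set (X × M)}
    (hT : ∀ z ∈ T, ∃ t ⊆ T, IsPartialIso r p R P t ∧ z ∈ t) (hd : Dense (Prod.fst '' T))
    (hiT : ∀ z ∈ T, i z.1 = z.2) : (∀ x, R (i x) = i (r x)) ∧ ∀ x, P (i x) = p x := by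
  have hR := h.isRetractStructure
  have hRc := hR.lipschitzWith.continuous
  have hPc := hR.height_lipschitzWith.continuous
  constructor
  · refine congrFun (Continuous.ext_on hd (hRc.comp hi.continuous)
      (hi.continuous.comp hr.lipschitzWith.continuous) ?_)
    rintro _ ⟨z, hz, rfl⟩
    obtain ⟨t, htT, ht, hzt⟩ := hT z hz
    simp only [hiT z hz, hiT _ (htT (ht.map z hzt))]
  · refine congrFun (Continuous.ext_on hd (hPc.comp hi.continuous)
      hr.height_lipschitzWith.continuous ?_)
    rintro _ ⟨z, hz, rfl⟩
    obtain ⟨t, htT, ht, hzt⟩ := hT z hz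
    simp only [hiT z hz, ht.height z hzt]

theorem exists_embedding (h : IsGenericRetraction R P) [SeparableSpace X]
    (hr : IsRetractStructure dist r p) :
    ∃ i : X → M, Isometry i ∧ (∀ x, R (i x) = i (r x)) ∧ ∀ x, P (i x) = p x := by
  have := h.complete
  obtain ⟨i, hi, T, hT, hd, hiT⟩ := exists_isometry_of_forth (P := IsPartialIso r p R P)
    (fun s hs => hs.isometric) (fun s hs x => h.exists_extension hr hs x) (s := ∅)
    ⟨finite_empty, fun z hz => hz.elim, fun z hz => hz.elim, fun z hz => hz.elim⟩
  exact ⟨i, hi, h.commutes_of_dense hr hi hT hd hiT⟩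

theorem exists_isometryEquiv (h : IsGenericRetraction R P) (h' : IsGenericRetraction r p)
    {s : Set (X × M)} (hs : IsPartialIso r p R P s) :
    ∃ Φ : X ≃ᵢ M, (∀ x, R (Φ x) = Φ (r x)) ∧ ∀ z ∈ s, Φ z.1 = z.2 := by
  have := h.complete
  have := h.separable
  have := h.nonempty
  have := h'.complete
  have := h'.separable
  have := h'.nonempty
  obtain ⟨Φ, T, hsT, hT, hd, hΦT⟩ := exists_isometryEquiv_of_back_and_forth
    (P := IsPartialIso r p R P) (fun s hs => hs.isometric)
    (fun s hs x => h.exists_extension h'.isRetractStructure hs x)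
    (fun s hs y => by
      obtain ⟨t, h₁, h₂, z, hz, rfl⟩ := h'.exists_extension h.isRetractStructure hs.swap y
      exact ⟨Prod.swap '' t, fun w hw => ⟨w.swap, h₁ ⟨w, hw, rfl⟩, w.swap_swap⟩, h₂.swap,
        z.swap, ⟨z, hz, rfl⟩, rfl⟩) hs
  exact ⟨Φ, (h.commutes_of_dense h'.isRetractStructure Φ.isometry hT hd hΦT).1,
    fun z hz => hΦT z (hsT hz)⟩

end PartialIso

end IsGenericRetraction

/-! ### Universality, ultrahomogeneity and the theorem -/

theorem IsLipschitzRetraction.isRetractStructure {X : Type*} [MetricSpace X] {r : X → X} {G : Set X}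
    (h : IsLipschitzRetraction r G) : IsRetractStructure dist r fun x => infDist x G where
  self := dist_self
  symm := dist_comm
  tri := dist_triangle
  lip x y := by simpa using h.lipschitz.dist_le_mul x y
  idem x := h.fixed _ (h.mem x)
  height_lip x y := infDist_le_infDist_add_dist
  height_map x := infDist_zero_of_mem (h.mem x)
  dist_map_le x := by
    -- For `y ∈ G`, both `x` and `r x` lie within `dist x y` of `y`; this is the source of the
    -- factor 2 in the structure axioms.
    have : dist x (r x) / 2 ≤ infDist x G := (le_infDist ⟨r x, h.mem x⟩).2 fun y hy => by
      have h₁ := h.lipschitz.dist_le_mul x y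
      rw [h.fixed y hy, NNReal.coe_one, one_mul] at h₁
      linarith [dist_triangle_right x (r x) y]
    linarith

theorem IsGenericRetraction.isUniversalRetraction {U : Type u} [MetricSpace U] {R : U → U}
    {P : U → ℝ} (h : IsGenericRetraction R P) :
    IsUniversalRetraction.{u, v} R {x | R x = x} := by
  intro X _ _ _ r G hr
  obtain ⟨i, hi, h₁, h₂⟩ := h.exists_embedding hr.isRetractStructure
  exact ⟨i, hi, h₁, fun x => by rw [← h.height_eq_infDist, h₂]⟩

theorem IsGenericRetraction.isUltrahomogeneousRetraction {U : Type u} [MetricSpace U] {R : U → U}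
    {P : U → ℝ} (h : IsGenericRetraction R P) :
    IsUltrahomogeneousRetraction R {x | R x = x} := by
  intro A B hA hB hAf hBf e hR hd
  have : Finite A := hAf
  have hs : IsPartialIso R P R P (range fun a : A => ((a : U), (e a : U))) :=
    { finite := finite_range _
      isometric := by
        rintro _ ⟨a, rfl⟩ _ ⟨b, rfl⟩
        exact (e.isometry.dist_eq a b).symm
      map := by
        rintro _ ⟨a, rfl⟩
        exact ⟨⟨R a, hA a.2⟩, by simp only [hR a]⟩
      height := by
        rintro _ ⟨a, rfl⟩
        simp only [h.height_eq_infDist, hd a] }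
  obtain ⟨Φ, h₁, h₂⟩ := h.exists_isometryEquiv h hs
  exact ⟨Φ, h₁, fun a => h₂ _ ⟨a, rfl⟩⟩

theorem theorem2p2 :
    (∃ (U : Type) (_ : MetricSpace U), IsUrysohnSpace U) ∧
    ∀ (U : Type u) [MetricSpace U], IsUrysohnSpace U →
      ∃ (R : U → U) (F : Set U),
        IsLipschitzRetraction R F ∧ F ⊂ Set.univ ∧ Nonempty (F ≃ᵢ U) ∧
        IsUniversalRetraction.{u, v} R F ∧ IsUltrahomogeneousRetraction R F := by
  obtain ⟨M, _, R, P, hM⟩ := exists_isGenericRetraction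
  refine ⟨⟨M, _, hM.isUrysohnSpace⟩, fun U _ hU => ?_⟩
  obtain ⟨e⟩ := hM.isUrysohnSpace.nonempty_isometryEquiv hU
  have h := hM.ofIsometryEquiv e
  exact ⟨_, _, h.isLipschitzRetraction, h.fixedPoints_ssubset_univ,
    h.isUrysohnSpace_fixedPoints.nonempty_isometryEquiv hU, h.isUniversalRetraction,
    h.isUltrahomogeneousRetraction⟩
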